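/- The terms of the linear substitution calculus (LSC) are $t,u ::= x \mid \lambda x.t \mid t\,u \mid t[x/u]$, where $\lambda x.t$ and the explicit substitution $t[x/u]$ bind $x$ in $t$; terms are considered modulo $\alpha$-equivalence. General contexts are terms with one hole $\langle\cdot\rangle$; shallow contexts are those given by $C ::= \langle\cdot\rangle \mid \lambda x.C \mid C\,t \mid t\,C \mid C[x/t]$ (the hole is never inside the content of an explicit substitution), and substitution contexts are $L ::= \langle\cdot\rangle \mid L[x/t]$; plugging $C\langle t\rangle$ may capture variables. The reduction $\to$ is the union of $\to_{\mathtt{dB}}$ and $\to_{\mathtt{ls}}$, the closures under shallow contexts of $$L\langle \lambda x.t\rangle\, u \mapsto_{\mathtt{dB}} L\langle t[x/u]\rangle, \qquad C\langle x\rangle[x/u] \mapsto_{\mathtt{ls}} C\langle u\rangle[x/u],$$ where $C$ is shallow and does not capture $x$, and where bound variables are renamed so that no variable of $u$ is captured. The $\mathtt{ls}$-step is said to duplicate $u$. The position of a redex is the context around the changing expression for a $\mathtt{dB}$-redex, and the context around the substituted variable occurrence for an $\mathtt{ls}$-redex. On the positions of a term, $C \prec_{LO} D$ means that the hole of $D$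 is strictly inside the subterm at the hole of $C$, or that $C$ and $D$ separate at an application or an explicit substitution, with the hole of $C$ in its left component and the hole of $D$ in its right component (the left component of $t[x/u]$ being $t$). A redex of a term after some steps is a residual of a redex of an earlier term if it is of the same kind and the application node (for $\mathtt{dB}$), respectively the variable occurrence (for $\mathtt{ls}$), at its position is a descendant (the same node, or a copy of it) of the one of the earlier redex. A derivation $\rho = R_1;\dots;R_n$ is standard if, for all $j<i$, $R_i$ is not a residual, after $R_j;\dots;R_{i-1}$, of a redex $Q$ with $Q\prec_{LO} R_j$. The size $|t|$ is the number of constructors (variable occurrences, abstractions, applications, explicit substitutions) of $t$. **Corollary.** Let $\rho : t \to^k u$ be a standard derivation of the LSC. Then: 1. (Subterm) every $\to_{\mathtt{ls}}$-step in $\rho$ duplicates a subterm of $t$ (up to $\alpha$-equivalence); 2. (No size explosion) $|u| \le (k+1)\cdot |t|$; 3. (Trace) if $t$ is an ordinary $\lambda$-term, i.e. without explicit substitutions, then the number of explicit substitutions in $u$ is equal to the number of $\mathtt{dB}$-steps in $\rho$. -/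

import Mathlib

namespace LSC

/-- Terms of the linear substitution calculus modulo `α`-equivalence, in de Bruijn notation:
`x | λx.t | t u | t[x/u]`. Both `lam t` and `sub t u` (the explicit substitution `t[x/u]`) bind
index `0` in `t`; `sub t u` binds nothing in `u`. -/
inductive Term : Type
  | var : ℕ → Term
  | lam : Term → Term
  | app : Term → Term → Term
  | sub : Term → Term → Term
  deriving DecidableEq

/-- The renaming `f` pushed under one binder. -/
def up (f : ℕ → ℕ) : ℕ → ℕ
  | 0 => 0
  | n + 1 => f n + 1

namespace Term

/-- Capture-avoiding renaming of the free variables. -/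
def rename : (ℕ → ℕ) → Term → Term
  | f, var n => var (f n)
  | f, lam t => lam (rename (up f) t)
  | f, app t u => app (rename f t) (rename f u)
  | f, sub t u => sub (rename (up f) t) (rename f u)

/-- The same term, placed under `n` more binders (none of which it uses). -/
def shift (n : ℕ) (t : Term) : Term := t.rename (· + n)

/-- `|t|`, the number of constructors. -/
def size : Term → ℕ
  | var _ => 1
  | lam t => t.size + 1
  | app t u => t.size + u.size + 1
  | sub t u => t.size + u.size + 1

/-- The number of explicit substitutions. -/
def esCount : Term → ℕ
  | var _ => 0
  | lam t => t.esCount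
  | app t u => t.esCount + u.esCount
  | sub t u => t.esCount + u.esCount + 1

/-- Ordinary `λ`-terms: no explicit substitution occurs. -/
def IsLambda : Term → Prop
  | var _ => True
  | lam t => t.IsLambda
  | app t u => t.IsLambda ∧ u.IsLambda
  | sub _ _ => False

end Term

/-- The five ways of descending from a node of a term to a child. -/
inductive Dir : Type
  | lam | appL | appR | subL | subR
  deriving DecidableEq

/-- General one-hole contexts. -/
inductive Ctx : Type
  | hole : Ctx
  | lam : Ctx → Ctx
  | appL : Ctx → Term → Ctx
  | appR : Term → Ctx → Ctx
  | subL : Ctx → Term → Ctx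
  | subR : Term → Ctx → Ctx
  deriving DecidableEq

namespace Ctx

/-- Plugging a term in the hole; the context may capture free variables of the term. -/
def plug : Ctx → Term → Term
  | hole, t => t
  | lam C, t => .lam (C.plug t)
  | appL C u, t => .app (C.plug t) u
  | appR u C, t => .app u (C.plug t)
  | subL C u, t => .sub (C.plug t) u
  | subR u C, t => .sub u (C.plug t)

/-- Plugging a context in the hole. -/
def comp : Ctx → Ctx → Ctx
  | hole, D => D
  | lam C, D => lam (C.comp D)
  | appL C u, D => appL (C.comp D) u
  | appR u C, D => appR u (C.comp D)
  | subL C u, D => subL (C.comp D) u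
  | subR u C, D => subR u (C.comp D)

/-- The number of binders whose scope contains the hole. -/
def depth : Ctx → ℕ
  | hole => 0
  | lam C => C.depth + 1
  | appL C _ => C.depth
  | appR _ C => C.depth
  | subL C _ => C.depth + 1
  | subR _ C => C.depth

/-- The path from the root to the hole. -/
def path : Ctx → List Dir
  | hole => []
  | lam C => .lam :: C.path
  | appL C _ => .appL :: C.path
  | appR _ C => .appR :: C.path
  | subL C _ => .subL :: C.path
  | subR _ C => .subR :: C.path

/-- Shallow contexts: the hole is not inside the content of an explicit substitution. -/
def Shallow : Ctx → Prop
  | hole => True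
  | lam C => C.Shallow
  | appL C _ => C.Shallow
  | appR _ C => C.Shallow
  | subL C _ => C.Shallow
  | subR _ _ => False

/-- Substitution contexts `L ::= ⟨·⟩ | L[x/t]`. -/
def IsSubst : Ctx → Prop
  | subL C _ => C.IsSubst
  | hole => True
  | _ => False

/-- `C` is a prefix of the term `t`. -/
def IsPrefix (C : Ctx) (t : Term) : Prop := ∃ u, C.plug u = t

/-- The outside-in order. -/
inductive Outside : Ctx → Ctx → Prop
  | root (C : Ctx) : C ≠ hole → Outside hole C
  | closure (E : Ctx) {C D : Ctx} : Outside C D → Outside (E.comp C) (E.comp D)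

/-- The left-to-right order. -/
inductive LeftOf : Ctx → Ctx → Prop
  | app {C D : Ctx} {t u : Term} : C.IsPrefix t → D.IsPrefix u → LeftOf (appL C u) (appR t D)
  | sub {C D : Ctx} {t u : Term} : C.IsPrefix t → D.IsPrefix u → LeftOf (subL C u) (subR t D)
  | closure (E : Ctx) {C D : Ctx} : LeftOf C D → LeftOf (E.comp C) (E.comp D)

/-- The left-to-right outside-in order. -/
def LO (C D : Ctx) : Prop := Outside C D ∨ LeftOf C D

end Ctx

/-- (Shallow) redexes, i.e. rewriting steps, with the data that determine them:
* `db D L t u` is `D⟨L⟨λx.t⟩ u⟩ → D⟨L⟨t[x/u]⟩⟩`;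
* `ls D C u` is `D⟨C⟨x⟩[x/u]⟩ → D⟨C⟨u⟩[x/u]⟩`, where `C` does not capture `x`. -/
inductive Redex : Type
  | db (D : Ctx) (hD : D.Shallow) (L : Ctx) (hL : L.IsSubst) (t u : Term) : Redex
  | ls (D : Ctx) (hD : D.Shallow) (C : Ctx) (hC : C.Shallow) (u : Term) : Redex

namespace Redex

/-- The term that contains the redex. In the `ls` case, the index `C.depth` in the hole of `C`
refers to the first binder outside `C`, i.e. to the explicit substitution. -/
def source : Redex → Term
  | db D _ L _ t u => D.plug (.app (L.plug (.lam t)) u)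
  | ls D _ C _ u => D.plug (.sub (C.plug (.var C.depth)) u)

/-- The result of the step. The moved term is shifted past the binders that it enters. -/
def target : Redex → Term
  | db D _ L _ t u => D.plug (L.plug (.sub t (u.shift L.depth)))
  | ls D _ C _ u => D.plug (.sub (C.plug (u.shift (C.depth + 1))) u)

/-- The position of a redex: the context around the changing expression for `db`, the context
around the substituted variable occurrence for `ls`. -/
def position : Redex → Ctx
  | db D _ _ _ _ _ => D
  | ls D _ C _ u => D.comp (.subL C u)

/-- Is this a `dB`-step? -/
def isDB : Redex → Bool
  | db _ _ _ _ _ _ => true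
  | ls _ _ _ _ _ => false

/-- `R.Trace p q`: the node at path `q` of `R.target` descends from (is, or is a copy of) the node
at path `p` of `R.source`. A `dB`-step erases the application and the abstraction that it fires;
an `ls`-step erases the substituted variable occurrence and copies all the nodes of the content
of the explicit substitution. -/
inductive Trace : Redex → List Dir → List Dir → Prop
  /-- Nodes that are not in the fired expression. -/
  | dbOut {D hD L hL t u} {p : List Dir} : ¬ D.path <+: p → Trace (db D hD L hL t u) p p
  /-- Nodes of the substitution context `L`. -/
  | dbSubst {D hD L hL t u} {p : List Dir} : ¬ L.path <+: p →
      Trace (db D hD L hL t u) (D.path ++ .appL :: p) (D.path ++ p)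
  /-- Nodes of the body of the abstraction. -/
  | dbBody {D hD L hL t u} (p : List Dir) :
      Trace (db D hD L hL t u) (D.path ++ .appL :: (L.path ++ .lam :: p))
        (D.path ++ (L.path ++ .subL :: p))
  /-- Nodes of the argument. -/
  | dbArg {D hD L hL t u} (p : List Dir) :
      Trace (db D hD L hL t u) (D.path ++ .appR :: p) (D.path ++ (L.path ++ .subR :: p))
  /-- All the nodes except for the substituted occurrence stay where they are. -/
  | lsStay {D hD C hC u} {p : List Dir} : p ≠ D.path ++ .subL :: C.path →
      Trace (ls D hD C hC u) p p
  /-- Nodes of the content of the explicit substitution also get a copy. -/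
  | lsCopy {D hD C hC u} (p : List Dir) :
      Trace (ls D hD C hC u) (D.path ++ .subR :: p) (D.path ++ .subL :: (C.path ++ p))

end Redex

/-- Descendants of nodes along a sequence of steps. -/
inductive Traces : List Redex → List Dir → List Dir → Prop
  | nil (p : List Dir) : Traces [] p p
  | cons {R : Redex} {ρ : List Redex} {p q r : List Dir} :
      R.Trace p q → Traces ρ q r → Traces (R :: ρ) p r

/-- `R` is a residual of `Q` after the sequence of steps `ρ`. A redex is followed through the node
at its position: the application of a `dB`-redex, the variable occurrence of an `ls`-redex. It is
meant for `Q` a redex of the first term of `ρ` and `R` a redex of the last one. -/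
def IsResidual (ρ : List Redex) (Q R : Redex) : Prop :=
  Q.isDB = R.isDB ∧ Traces ρ Q.position.path R.position.path

/-- `IsDerivation t ρ u`: the sequence of redexes `ρ` is a derivation from `t` to `u`. -/
inductive IsDerivation : Term → List Redex → Term → Prop
  | nil (t : Term) : IsDerivation t [] t
  | cons (R : Redex) {ρ : List Redex} {u : Term} :
      IsDerivation R.target ρ u → IsDerivation R.source (R :: ρ) u

/-- Standard derivations: no reduced redex is the residual, after the steps from the `j`-th one on,
of a redex `Q` that came before the `j`-th reduced redex in the left-to-right outside-in order.
Here `σ` is the sequence of the steps `R_j, …, R_{i-1}` and `R` is `R_i`. -/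
def IsStandard (ρ : List Redex) : Prop :=
  ∀ (τ σ θ : List Redex) (S R Q : Redex), ρ = τ ++ (S :: σ) ++ (R :: θ) →
    Q.source = S.source → Q.position.LO S.position → ¬ IsResidual (S :: σ) Q R

/-- The term `u`, regarded in the scope of `d` binders, is a subterm of `t` modulo `α`-equivalence.
Some general context `P` and term `v` have `t = P⟨v⟩`, and `u` is `v` up to the injective renaming
`f` that sends the free variables of `v` bound by `P` to variables bound by the `d` binders,
and leaves the variables that are free in `t` what they are. -/
def IsSubterm (d : ℕ) (u t : Term) : Prop :=
  ∃ (P : Ctx) (v : Term) (f : ℕ → ℕ), P.plug v = t ∧ Function.Injective f ∧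
    (∀ i, i < P.depth → f i < d) ∧ (∀ i, f (P.depth + i) = d + i) ∧ u = v.rename f

/-- The number of `dB`-steps of a derivation. -/
def dbCount (ρ : List Redex) : ℕ := ρ.countP Redex.isDB

end LSC

namespace LSC

/-! ### Renaming, plugging and measures -/

/-! Fix the initial term `t`. Around the position of the last step, every application argument and
every substitution content that lies to the right of the hole or at a shallow position of the
plugged term is, up to renaming, a subterm of `t` (`Ctx.ArgsFrom`). Only the parts to the left of
the hole may have been altered. A step keeps this invariant (`Redex.argsFrom_target`): `dB` turns an
argument into a content, and `ls` pastes a content that lies on its own path. The next position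
inherits the invariant (`Ctx.ArgsFrom.of_not_before`) unless it is above or to the left of an
application argument containing the previous position (`Ctx.Before`). In that case its redex already
existed before the previous step and preceded it in the LO order
(`Redex.exists_isResidual_of_before`), which standardness of two consecutive steps forbids. Hence
each `ls`-step duplicates a subterm of `t`, so it adds fewer than `|t|` constructors, and no
explicit substitution if `t` is a `λ`-term. A `dB`-step removes one constructor and creates one
explicit substitution. -/

theorem up_comp (f g : ℕ → ℕ) : up f ∘ up g = up (f ∘ g) := by
  funext n; cases n <;> rfl

theorem up_injective {f : ℕ → ℕ} (hf : Function.Injective f) : Function.Injective (up f) := by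
  intro a b h
  cases a <;> cases b <;> simp only [up] at h
  · rfl
  · omega
  · omega
  · rw [hf (Nat.succ.inj h)]

theorem up_id : up id = id := by
  funext n; cases n <;> rfl

namespace Term

theorem rename_rename (f g : ℕ → ℕ) (t : Term) :
    (t.rename g).rename f = t.rename (f ∘ g) := by
  induction t generalizing f g with
  | var n => rfl
  | lam t ih => simp [rename, ih, up_comp]
  | app t u iht ihu => simp [rename, iht, ihu]
  | sub t u iht ihu => simp [rename, iht, ihu, up_comp]

theorem rename_id (t : Term) : t.rename id = t := by
  induction t with
  | var n => rfl
  | lam t ih => simp [rename, ih, up_id]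
  | app t u iht ihu => simp [rename, iht, ihu]
  | sub t u iht ihu => simp [rename, iht, ihu, up_id]

theorem size_rename (f : ℕ → ℕ) (t : Term) : (t.rename f).size = t.size := by
  induction t generalizing f with
  | var n => rfl
  | lam t ih => simp [rename, size, ih]
  | app t u iht ihu => simp [rename, size, iht, ihu]
  | sub t u iht ihu => simp [rename, size, iht, ihu]

theorem esCount_rename (f : ℕ → ℕ) (t : Term) : (t.rename f).esCount = t.esCount := by
  induction t generalizing f with
  | var n => rfl
  | lam t ih => simp [rename, esCount, ih]
  | app t u iht ihu => simp [rename, esCount, iht, ihu]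
  | sub t u iht ihu => simp [rename, esCount, iht, ihu]

theorem IsLambda.esCount_eq_zero {t : Term} (h : t.IsLambda) : t.esCount = 0 := by
  induction t with
  | var n => rfl
  | lam t ih => exact ih h
  | app t u iht ihu => simp [esCount, iht h.1, ihu h.2]
  | sub t u => exact h.elim

end Term

namespace Ctx

theorem plug_comp (C D : Ctx) (t : Term) : (C.comp D).plug t = C.plug (D.plug t) := by
  induction C <;> simp_all [comp, plug]

theorem depth_comp (C D : Ctx) : (C.comp D).depth = C.depth + D.depth := by
  induction C <;> simp_all [comp, depth] <;> omega

theorem path_comp (C D : Ctx) : (C.comp D).path = C.path ++ D.path := by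
  induction C <;> simp_all [comp, path]

theorem shallow_iff (C : Ctx) : C.Shallow ↔ Dir.subR ∉ C.path := by
  induction C <;> simp_all [Shallow, path]

theorem depth_congr {C D : Ctx} (h : C.path = D.path) : C.depth = D.depth := by
  induction C generalizing D with
  | hole => cases D <;> simp_all [path, depth]
  | lam C ih | appL C b ih | appR b C ih | subL C b ih | subR b C ih =>
    cases D <;> simp [path] at h
    simp only [depth, ih h]

/-- Recovers the shape of an `ls` position from its path alone, when the side terms of the context
have changed. -/
theorem exists_eq_comp_subL {P : Ctx} {p q : List Dir} (h : P.path = p ++ .subL :: q) :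
    ∃ (D C : Ctx) (u : Term), P = D.comp (.subL C u) ∧ D.path = p ∧ C.path = q := by
  induction p generalizing P with
  | nil =>
    cases P <;> simp [path] at h
    exact ⟨hole, _, _, rfl, rfl, h⟩
  | cons a p ih =>
    cases P <;> simp [path] at h <;> obtain ⟨rfl, h⟩ := h <;>
      obtain ⟨D, C, u, rfl, hD, hC⟩ := ih h
    · exact ⟨lam D, C, u, rfl, by simp [path, hD], hC⟩
    · exact ⟨appL D _, C, u, rfl, by simp [path, hD], hC⟩
    · exact ⟨appR _ D, C, u, rfl, by simp [path, hD], hC⟩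
    · exact ⟨subL D _, C, u, rfl, by simp [path, hD], hC⟩
    · exact ⟨subR _ D, C, u, rfl, by simp [path, hD], hC⟩

/-- The additive form avoids truncated subtraction when one plugged term replaces another. -/
theorem size_plug (P : Ctx) (v w : Term) :
    (P.plug v).size + w.size = (P.plug w).size + v.size := by
  induction P <;> simp only [plug, Term.size] <;> omega

theorem esCount_plug (P : Ctx) (v w : Term) :
    (P.plug v).esCount + w.esCount = (P.plug w).esCount + v.esCount := by
  induction P <;> simp only [plug, Term.esCount] <;> omega

theorem le_size_plug (P : Ctx) (v : Term) : v.size ≤ (P.plug v).size := by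
  induction P <;> simp only [plug, Term.size] <;> omega

theorem le_esCount_plug (P : Ctx) (v : Term) : v.esCount ≤ (P.plug v).esCount := by
  induction P <;> simp only [plug, Term.esCount] <;> omega

end Ctx

/-! ### Subterms -/

namespace IsSubterm

theorem refl (t : Term) : IsSubterm 0 t t :=
  ⟨.hole, t, id, rfl, Function.injective_id, fun _ h => absurd h (Nat.not_lt_zero _),
    fun _ => rfl, t.rename_id.symm⟩

theorem shift {d : ℕ} {u t : Term} (h : IsSubterm d u t) (n : ℕ) :
    IsSubterm (d + n) (u.shift n) t := by
  obtain ⟨P, v, f, hP, hf, hlt, hge, rfl⟩ := h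
  refine ⟨P, v, (· + n) ∘ f, hP, (add_left_injective n).comp hf, fun i hi => ?_, fun i => ?_, ?_⟩
  · have := hlt i hi
    simp only [Function.comp_apply]; omega
  · simp only [Function.comp_apply, hge]; omega
  · rw [Term.shift, Term.rename_rename]

theorem size_le {d : ℕ} {u t : Term} (h : IsSubterm d u t) : u.size ≤ t.size := by
  obtain ⟨P, v, f, rfl, -, -, -, rfl⟩ := h
  rw [Term.size_rename]
  exact P.le_size_plug v

theorem esCount_eq_zero {d : ℕ} {u t : Term} (h : IsSubterm d u t) (ht : t.IsLambda) :
    u.esCount = 0 := by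
  have h0 := ht.esCount_eq_zero
  obtain ⟨P, v, f, rfl, -, -, -, rfl⟩ := h
  rw [Term.esCount_rename]
  have := P.le_esCount_plug v
  omega

theorem up_lt {d m : ℕ} {f : ℕ → ℕ} (h : ∀ i, i < m → f i < d) :
    ∀ i, i < m + 1 → up f i < d + 1
  | 0, _ => Nat.succ_pos _
  | i + 1, hi => Nat.succ_lt_succ (h i (Nat.lt_of_succ_lt_succ hi))

theorem up_add {d m : ℕ} {f : ℕ → ℕ} (h : ∀ i, f (m + i) = d + i) (i : ℕ) :
    up f (m + 1 + i) = d + 1 + i := by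
  rw [show m + 1 + i = (m + i) + 1 by omega]
  simp only [up, h]; omega

theorem of_lam {d : ℕ} {a t : Term} (h : IsSubterm d (.lam a) t) : IsSubterm (d + 1) a t := by
  obtain ⟨P, v, f, rfl, hf, hlt, hge, e⟩ := h
  cases v <;> simp [Term.rename] at e
  exact ⟨P.comp (.lam .hole), _, up f, by simp [Ctx.plug_comp, Ctx.plug], up_injective hf,
    by simpa [Ctx.depth_comp, Ctx.depth] using up_lt hlt,
    by simpa [Ctx.depth_comp, Ctx.depth] using up_add hge, e⟩

theorem of_appL {d : ℕ} {a b t : Term} (h : IsSubterm d (.app a b) t) : IsSubterm d a t := by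
  obtain ⟨P, v, f, rfl, hf, hlt, hge, e⟩ := h
  cases v <;> simp [Term.rename] at e
  exact ⟨P.comp (.appL .hole _), _, f, by simp [Ctx.plug_comp, Ctx.plug]; rfl, hf,
    by simpa [Ctx.depth_comp, Ctx.depth] using hlt,
    by simpa [Ctx.depth_comp, Ctx.depth] using hge, e.1⟩

theorem of_appR {d : ℕ} {a b t : Term} (h : IsSubterm d (.app a b) t) : IsSubterm d b t := by
  obtain ⟨P, v, f, rfl, hf, hlt, hge, e⟩ := h
  cases v <;> simp [Term.rename] at e
  exact ⟨P.comp (.appR _ .hole), _, f, by simp [Ctx.plug_comp, Ctx.plug]; rfl, hf,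
    by simpa [Ctx.depth_comp, Ctx.depth] using hlt,
    by simpa [Ctx.depth_comp, Ctx.depth] using hge, e.2⟩

theorem of_subL {d : ℕ} {a b t : Term} (h : IsSubterm d (.sub a b) t) :
    IsSubterm (d + 1) a t := by
  obtain ⟨P, v, f, rfl, hf, hlt, hge, e⟩ := h
  cases v <;> simp [Term.rename] at e
  exact ⟨P.comp (.subL .hole _), _, up f, by simp [Ctx.plug_comp, Ctx.plug]; rfl,
    up_injective hf, by simpa [Ctx.depth_comp, Ctx.depth] using up_lt hlt,
    by simpa [Ctx.depth_comp, Ctx.depth] using up_add hge, e.1⟩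

theorem of_subR {d : ℕ} {a b t : Term} (h : IsSubterm d (.sub a b) t) : IsSubterm d b t := by
  obtain ⟨P, v, f, rfl, hf, hlt, hge, e⟩ := h
  cases v <;> simp [Term.rename] at e
  exact ⟨P.comp (.subR _ .hole), _, f, by simp [Ctx.plug_comp, Ctx.plug]; rfl, hf,
    by simpa [Ctx.depth_comp, Ctx.depth] using hlt,
    by simpa [Ctx.depth_comp, Ctx.depth] using hge, e.2⟩

end IsSubterm

/-! ### Terms and positions whose arguments come from a given term -/

/-- In the scope of `d` binders, all the arguments of applications and all the contents of explicit
substitutions at shallow positions of the second term are subterms of `t`. -/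
def Term.ArgsFrom (t : Term) : ℕ → Term → Prop
  | _, .var _ => True
  | d, .lam a => Term.ArgsFrom t (d + 1) a
  | d, .app a b => Term.ArgsFrom t d a ∧ IsSubterm d b t
  | d, .sub a b => Term.ArgsFrom t (d + 1) a ∧ IsSubterm d b t

/-- In the scope of `d` binders, the context is shallow, the arguments and contents to the right of
its hole are subterms of `t`, and so are those in the term `v` plugged in the hole. -/
def Ctx.ArgsFrom (t v : Term) : ℕ → Ctx → Prop
  | d, .hole => Term.ArgsFrom t d v
  | d, .lam P => Ctx.ArgsFrom t v (d + 1) P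
  | d, .appL P b => Ctx.ArgsFrom t v d P ∧ IsSubterm d b t
  | d, .appR _ P => Ctx.ArgsFrom t v d P
  | d, .subL P b => Ctx.ArgsFrom t v (d + 1) P ∧ IsSubterm d b t
  | _, .subR _ _ => False

theorem IsSubterm.argsFrom {t : Term} {d : ℕ} {u : Term} (h : IsSubterm d u t) :
    Term.ArgsFrom t d u := by
  induction u generalizing d with
  | var n => trivial
  | lam a ih => exact ih h.of_lam
  | app a b iha _ => exact ⟨iha h.of_appL, h.of_appR⟩
  | sub a b iha _ => exact ⟨iha h.of_subL, h.of_subR⟩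

namespace Ctx

theorem argsFrom_of_plug {t v : Term} {d : ℕ} {P : Ctx} (hP : P.Shallow)
    (h : Term.ArgsFrom t d (P.plug v)) : Ctx.ArgsFrom t v d P := by
  induction P generalizing d with
  | hole => exact h
  | lam P ih => exact ih (d := d + 1) hP h
  | appL P b ih => exact ⟨ih hP h.1, h.2⟩
  -- The function `a` is forgotten. The argument is itself a subterm of `t`, so the hypothesis
  -- restarts inside it.
  | appR a P ih => exact ih hP h.2.argsFrom
  | subL P b ih => exact ⟨ih hP h.1, h.2⟩
  | subR a P => exact hP.elim

/-- Only `appR` makes a context forget the origin of its plugged term as an argument; without it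
nothing is lost by moving up. -/
theorem ArgsFrom.plug {t v : Term} {d : ℕ} {P : Ctx} (h : Ctx.ArgsFrom t v d P)
    (hP : Dir.appR ∉ P.path) : Term.ArgsFrom t d (P.plug v) := by
  induction P generalizing d with
  | hole => exact h
  | lam P ih => exact ih (d := d + 1) h (by simpa [path] using hP)
  | appL P b ih => exact ⟨ih h.1 (by simpa [path] using hP), h.2⟩
  | appR a P => simp [path] at hP
  | subL P b ih => exact ⟨ih h.1 (by simpa [path] using hP), h.2⟩
  | subR a P => exact h.elim

theorem ArgsFrom.mono {t v w : Term} {d : ℕ} {P : Ctx} (h : Ctx.ArgsFrom t v d P)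
    (hvw : Term.ArgsFrom t (d + P.depth) v → Term.ArgsFrom t (d + P.depth) w) :
    Ctx.ArgsFrom t w d P := by
  induction P generalizing d with
  | hole => exact hvw h
  | lam P ih => exact ih (d := d + 1) h (by rwa [depth, ← Nat.add_assoc, Nat.add_right_comm] at hvw)
  | appL P b ih => exact ⟨ih h.1 hvw, h.2⟩
  | appR a P ih => exact ih (d := d) h hvw
  | subL P b ih =>
    exact ⟨ih h.1 (by rwa [depth, ← Nat.add_assoc, Nat.add_right_comm] at hvw), h.2⟩
  | subR a P => exact h.elim

theorem ArgsFrom.isSubterm_content {t v u : Term} {d : ℕ} {D C : Ctx}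
    (h : Ctx.ArgsFrom t v d (D.comp (.subL C u))) : IsSubterm (d + D.depth) u t := by
  induction D generalizing d with
  | hole => exact h.2
  | lam P ih => rw [depth, ← Nat.add_assoc, Nat.add_right_comm]; exact ih (d := d + 1) h
  | appL P b ih => exact ih h.1
  | appR a P ih => exact ih (d := d) h
  | subL P b ih => rw [depth, ← Nat.add_assoc, Nat.add_right_comm]; exact ih h.1
  | subR a P => exact h.elim

theorem argsFrom_dB {t a u : Term} {L : Ctx} (hL : L.IsSubst) {d n : ℕ} (hn : n = d + L.depth)
    (hu : IsSubterm n u t) (h : Term.ArgsFrom t d (L.plug (.lam a))) :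
    Term.ArgsFrom t d (L.plug (.sub a u)) := by
  induction L generalizing d with
  | hole => subst hn; exact ⟨h, hu⟩
  | subL L b ih => exact ⟨ih hL (by rw [hn, depth]; omega) h.1, h.2⟩
  | _ => exact hL.elim

/-! ### Positions that a step leaves untouched -/

/-- `Before P' P`: the hole of `P'` is above or to the left of some application argument in which
the hole of `P` lies. -/
def Before : Ctx → Ctx → Prop
  | hole, P => Dir.appR ∈ P.path
  | lam P', lam P => Before P' P
  | appL _ _, appR _ _ => True
  | appL P' _, appL P _ => Before P' P
  | appR _ P', appR _ P => Before P' P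
  | subL P' _, subL P _ => Before P' P
  | _, _ => False

/-- The new position is above the old one without leaving an argument, below it, or to its right
inside an argument known to be a subterm of `t`. -/
theorem ArgsFrom.of_not_before {t v w : Term} {d : ℕ} {P P' : Ctx} (h : Ctx.ArgsFrom t v d P)
    (hP' : P'.Shallow) (e : P'.plug w = P.plug v) (hb : ¬ Before P' P) :
    Ctx.ArgsFrom t w d P' := by
  induction P generalizing d P' with
  | hole => exact argsFrom_of_plug hP' (by rw [e]; exact h)
  | subR a P => exact h.elim
  | lam P ih =>
    cases P' <;> simp only [Ctx.plug, Term.lam.injEq, reduceCtorEq] at e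
    · subst e; exact ArgsFrom.plug (P := lam P) h hb
    · exact ih (d := d + 1) h hP' e hb
  | appL P b ih =>
    cases P' <;> simp only [Ctx.plug, Term.app.injEq, reduceCtorEq] at e
    · subst e; exact ArgsFrom.plug (P := appL P b) h hb
    · exact ⟨ih h.1 hP' e.1 hb, e.2 ▸ h.2⟩
    · rename_i Q
      exact argsFrom_of_plug (P := Q) hP' (by rw [e.2]; exact h.2.argsFrom)
  | appR a P ih =>
    cases P' <;> simp only [Ctx.plug, Term.app.injEq, reduceCtorEq] at e
    -- Moving above this argument, or left into its function, is exactly what `Before` excludes.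
    · exact absurd (by simp [Before, path]) hb
    · exact absurd trivial hb
    · rename_i Q
      exact ih (d := d) (P' := Q) h hP' e.2 hb
  | subL P b ih =>
    cases P' <;> simp only [Ctx.plug, Term.sub.injEq, reduceCtorEq] at e
    · subst e; exact ArgsFrom.plug (P := subL P b) h hb
    · exact ⟨ih h.1 hP' e.1 hb, e.2 ▸ h.2⟩
    · exact hP'.elim

/-- The node at `P'` is thus outside the expression changed at `P`, so the step leaves it in place.
-/
theorem Before.not_isPrefix {P' P : Ctx} (h : Before P' P) : ¬ P.path <+: P'.path := by
  induction P generalizing P' with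
  | hole => cases P' <;> simp [Before, path] at h
  | _ => cases P' <;> simp_all [Before, path]

/-! ### Pulling redexes back across a step -/

theorem LO.closure (E : Ctx) {C D : Ctx} (h : LO C D) : LO (E.comp C) (E.comp D) :=
  h.imp (Outside.closure E) (LeftOf.closure E)

/-- The left component of a redex at the root survives changes inside a term argument. -/
theorem exists_isSubst_plug_lam {L Q : Ctx} (hL : L.IsSubst) (hQ : Q.Shallow)
    (h : Dir.appR ∈ Q.path) {a v' : Term} (e : L.plug (.lam a) = Q.plug v') (v : Term) :
    ∃ (L' : Ctx) (a' : Term), L'.IsSubst ∧ L'.plug (.lam a') = Q.plug v := by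
  induction L generalizing Q with
  | hole =>
    -- A substitution spine crosses no application, so the change lies in the body of the
    -- abstraction.
    cases Q <;> simp [plug, path] at e h
    exact ⟨hole, _, trivial, rfl⟩
  | subL L b ih =>
    cases Q <;> simp [plug, path] at e h
    · rename_i Q c
      obtain ⟨L', a', h1, h2⟩ := ih (Q := Q) hL hQ h e.1
      exact ⟨subL L' b, a', h1, by simp [plug, h2, e.2]⟩
    · exact hQ.elim
  | _ => exact hL.elim

/-- `v'` is the reduct and `v` the original expression: undoing the step alters only side terms of
`P'`, hence a new context with the same path. -/
theorem Before.exists_var {P' P : Ctx} (h : Before P' P) {n : ℕ} {v' : Term}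
    (e : P'.plug (.var n) = P.plug v') (v : Term) :
    ∃ P'' : Ctx, P''.plug (.var n) = P.plug v ∧ P''.path = P'.path ∧ LO P'' P := by
  induction P' generalizing P with
  | hole => cases P <;> simp [plug, Before, path] at e h
  | subR => cases P <;> exact h.elim
  | lam P' ih =>
    cases P <;> simp only [Before] at h
    obtain ⟨P'', h1, h2, h3⟩ := ih h (by simpa [plug] using e)
    exact ⟨lam P'', by simp [plug, h1], by simp [path, h2], h3.closure (lam hole)⟩
  | appL P' b ih =>
    cases P with
    | appL P c =>
      obtain ⟨P'', h1, h2, h3⟩ := ih h (Term.app.inj e).1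
      exact ⟨appL P'' c, by simp [plug, h1], by simp [path, h2], h3.closure (appL hole c)⟩
    | appR c P =>
      have e1 := (Term.app.inj e).1
      -- The positions separate here: the step acted wholly in the right sibling of `P'`, which is
      -- reset.
      exact ⟨appL P' (P.plug v), by simp [plug, e1], rfl, .inr (.app ⟨_, e1⟩ ⟨_, rfl⟩)⟩
    | _ => exact h.elim
  | appR b P' ih =>
    cases P with
    | appR c P =>
      obtain ⟨P'', h1, h2, h3⟩ := ih h (Term.app.inj e).2
      exact ⟨appR c P'', by simp [plug, h1], by simp [path, h2], h3.closure (appR c hole)⟩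
    | _ => exact h.elim
  | subL P' b ih =>
    cases P with
    | subL P c =>
      obtain ⟨P'', h1, h2, h3⟩ := ih h (Term.sub.inj e).1
      exact ⟨subL P'' c, by simp [plug, h1], by simp [path, h2], h3.closure (subL hole c)⟩
    | _ => exact h.elim

theorem Before.exists_app {P' P : Ctx} (h : Before P' P) (hP : P.Shallow) {L : Ctx}
    (hL : L.IsSubst) {a b v' : Term} (e : P'.plug (.app (L.plug (.lam a)) b) = P.plug v')
    (v : Term) :
    ∃ (P'' L' : Ctx) (a' b' : Term), L'.IsSubst ∧
      P''.plug (.app (L'.plug (.lam a')) b') = P.plug v ∧ P''.path = P'.path ∧ LO P'' P := by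
  induction P' generalizing P with
  | hole =>
    have hne : P ≠ hole := by rintro rfl; simp [Before, path] at h
    have hLO : LO hole P := .inl (.root P hne)
    cases P with
    | appL P c =>
      obtain ⟨L', a', h1, h2⟩ := exists_isSubst_plug_lam hL (Q := P) hP
        (by simpa [Before, path] using h) (Term.app.inj e).1 v
      exact ⟨hole, L', a', c, h1, by simp [plug, h2], rfl, hLO⟩
    | appR c P =>
      exact ⟨hole, L, a, P.plug v, hL, by simp [plug, (Term.app.inj e).1], rfl, hLO⟩
    | hole => exact absurd rfl hne
    | _ => simp [plug] at e
  | subR => cases P <;> exact h.elim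
  | lam P' ih =>
    cases P <;> simp only [Before] at h
    obtain ⟨P'', L', a', b', h0, h1, h2, h3⟩ := ih h hP (by simpa [plug] using e)
    exact ⟨lam P'', L', a', b', h0, by simp [plug, h1], by simp [path, h2], h3.closure (lam hole)⟩
  | appL P' b ih =>
    cases P with
    | appL P c =>
      obtain ⟨P'', L', a', b', h0, h1, h2, h3⟩ := ih h hP (Term.app.inj e).1
      exact ⟨appL P'' c, L', a', b', h0, by simp [plug, h1], by simp [path, h2],
        h3.closure (appL hole c)⟩
    | appR c P =>
      have e1 := (Term.app.inj e).1
      exact ⟨appL P' (P.plug v), L, a, _, hL, by rw [plug, plug, e1], rfl,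
        .inr (.app ⟨_, e1⟩ ⟨_, rfl⟩)⟩
    | _ => exact h.elim
  | appR b P' ih =>
    cases P with
    | appR c P =>
      obtain ⟨P'', L', a', b', h0, h1, h2, h3⟩ := ih h hP (Term.app.inj e).2
      exact ⟨appR c P'', L', a', b', h0, by simp [plug, h1], by simp [path, h2],
        h3.closure (appR c hole)⟩
    | _ => exact h.elim
  | subL P' b ih =>
    cases P with
    | subL P c =>
      obtain ⟨P'', L', a', b', h0, h1, h2, h3⟩ := ih h hP (Term.sub.inj e).1
      exact ⟨subL P'' c, L', a', b', h0, by simp [plug, h1], by simp [path, h2],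
        h3.closure (subL hole c)⟩
    | _ => exact h.elim

end Ctx

/-! ### Steps -/

namespace Redex

/-- The expressions at the position of a redex before and after the step. -/
def exprs : Redex → Term × Term
  | db _ _ L _ t u => (.app (L.plug (.lam t)) u, L.plug (.sub t (u.shift L.depth)))
  | ls _ _ C _ u => (.var C.depth, u.shift (C.depth + 1))

theorem plug_position_fst (R : Redex) : R.position.plug R.exprs.1 = R.source := by
  cases R <;> simp [position, exprs, source, Ctx.plug_comp, Ctx.plug]

theorem plug_position_snd (R : Redex) : R.position.plug R.exprs.2 = R.target := by
  cases R <;> simp [position, exprs, target, Ctx.plug_comp, Ctx.plug]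

theorem shallow_position (R : Redex) : R.position.Shallow := by
  cases R with
  | db D hD => exact hD
  | ls D hD C hC u =>
    rw [Ctx.shallow_iff] at *
    simp [position, Ctx.path_comp, Ctx.path, hD, hC]

theorem trace_of_before {S : Redex} {P : Ctx} (h : P.Before S.position) :
    S.Trace P.path P.path := by
  have := h.not_isPrefix
  cases S with
  | db D hD L hL t u => exact .dbOut this
  | ls D hD C hC u =>
    refine .lsStay fun e => this ?_
    rw [e, position, Ctx.path_comp]
    exact List.prefix_rfl

/-- A redex whose position is `Before` that of the preceding step is the residual of a redex that
is smaller than that step in the left-to-right outside-in order. -/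
theorem exists_isResidual_of_before {S R : Redex} (e : R.source = S.target)
    (h : R.position.Before S.position) :
    ∃ Q : Redex, Q.source = S.source ∧ Q.position.LO S.position ∧ IsResidual [S] Q R := by
  have htr := trace_of_before h
  rw [← plug_position_snd S] at e
  rw [← plug_position_fst S]
  cases R with
  | db D hD L hL a b =>
    obtain ⟨D', L', a', b', hL', h1, h2, h3⟩ :=
      h.exists_app S.shallow_position hL e S.exprs.1
    have hD' : D'.Shallow := by rwa [Ctx.shallow_iff, h2, ← Ctx.shallow_iff]
    refine ⟨db D' hD' L' hL' a' b', h1, h3, rfl, .cons ?_ (.nil _)⟩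
    change S.Trace D'.path D.path
    rw [h2]; exact htr
  | ls D hD C hC u =>
    rw [← plug_position_fst] at e
    obtain ⟨P, h1, h2, h3⟩ := h.exists_var e S.exprs.1
    have h2' : P.path = D.path ++ .subL :: C.path := by
      rw [h2, position, Ctx.path_comp]; rfl
    obtain ⟨D', C', u', rfl, hD', hC'⟩ := Ctx.exists_eq_comp_subL h2'
    refine ⟨ls D' (by rwa [Ctx.shallow_iff, hD', ← Ctx.shallow_iff])
      C' (by rwa [Ctx.shallow_iff, hC', ← Ctx.shallow_iff]) u', ?_, h3, rfl, .cons ?_ (.nil _)⟩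
    -- Equal paths cross equally many binders, so the index still points to the same explicit
    -- substitution.
    · rw [← plug_position_fst, exprs, Ctx.depth_congr hC']; exact h1
    · change S.Trace (D'.comp (.subL C' u')).path _
      rw [h2]; exact htr

theorem argsFrom_target {t : Term} {R : Redex}
    (h : Ctx.ArgsFrom t R.exprs.1 0 R.position) :
    Ctx.ArgsFrom t R.exprs.2 0 R.position := by
  refine h.mono fun hv => ?_
  cases R with
  | db D hD L hL a u => exact Ctx.argsFrom_dB hL rfl (hv.2.shift _) hv.1
  | ls D hD C hC u =>
    have := (h.isSubterm_content.shift (C.depth + 1)).argsFrom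
    simpa [position, exprs, Ctx.depth_comp, Ctx.depth] using this

end Redex

/-! ### The invariant along a standard derivation -/

theorem IsStandard.tail {R : Redex} {ρ : List Redex} (h : IsStandard (R :: ρ)) :
    IsStandard ρ := fun τ σ θ S R' Q e => h (R :: τ) σ θ S R' Q (by rw [e]; rfl)

theorem IsStandard.not_before {S R : Redex} {θ : List Redex} (h : IsStandard (S :: R :: θ))
    (e : R.source = S.target) : ¬ R.position.Before S.position := fun hb => by
  obtain ⟨Q, h1, h2, h3⟩ := Redex.exists_isResidual_of_before e hb
  exact h [] [] θ S R Q rfl h1 h2 h3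

theorem IsDerivation.source_eq {t u : Term} {R : Redex} {θ : List Redex}
    (h : IsDerivation t (R :: θ) u) : R.source = t := by
  cases h; rfl

/-- `t₀` stays fixed while `t` advances; `hb` carries the only use of standardness across the
boundary with the preceding step. -/
theorem IsDerivation.bounds {t₀ t u : Term} {ρ : List Redex} (hρ : IsDerivation t ρ u)
    (hstd : IsStandard ρ) {P : Ctx} {v : Term} (e : P.plug v = t)
    (hP : Ctx.ArgsFrom t₀ v 0 P) (hb : ∀ R θ, ρ = R :: θ → ¬ R.position.Before P) :
    (∀ (D : Ctx) (hD : D.Shallow) (C : Ctx) (hC : C.Shallow) (w : Term),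
        Redex.ls D hD C hC w ∈ ρ → IsSubterm D.depth w t₀) ∧
      u.size ≤ t.size + ρ.length * t₀.size ∧
      (t₀.IsLambda → u.esCount = t.esCount + dbCount ρ) := by
  induction hρ generalizing P v with
  | nil t => simp [dbCount]
  | @cons R ρ u hρ ih =>
    rw [← R.plug_position_fst] at e
    have hR := hP.of_not_before R.shallow_position e.symm (hb R ρ rfl)
    obtain ⟨ih1, ih2, ih3⟩ := ih hstd.tail R.plug_position_snd (Redex.argsFrom_target hR)
      (by rintro R' θ rfl; exact hstd.not_before hρ.source_eq)
    have hsize := R.position.size_plug R.exprs.1 R.exprs.2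
    have hes := R.position.esCount_plug R.exprs.1 R.exprs.2
    rw [R.plug_position_fst, R.plug_position_snd] at hsize hes
    rw [List.length_cons, Nat.succ_mul]
    cases R with
    | db D hD L hL a b =>
      refine ⟨fun D' hD' C' hC' w hw => ih1 D' hD' C' hC' w (by simpa using hw), ?_, fun h => ?_⟩
      · have := L.size_plug (.lam a) (.sub a (b.shift L.depth))
        have hb := Term.size_rename (· + L.depth) b
        simp only [Redex.exprs, Term.size, Term.shift] at *
        omega
      · have := L.esCount_plug (.lam a) (.sub a (b.shift L.depth))
        have hb := Term.esCount_rename (· + L.depth) b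
        have := ih3 h
        simp only [Redex.exprs, Term.esCount, Term.shift, dbCount, List.countP_cons,
          Redex.isDB, if_true] at *
        omega
    | ls D hD C hC w =>
      have hw : IsSubterm D.depth w t₀ := by simpa using hR.isSubterm_content
      refine ⟨fun D' hD' C' hC' w' hw' => ?_, ?_, fun h => ?_⟩
      · rcases List.mem_cons.1 hw' with h | h
        · cases h; exact hw
        · exact ih1 D' hD' C' hC' w' h
      · have h1 := Term.size_rename (· + (C.depth + 1)) w
        have h2 := hw.size_le
        simp only [Redex.exprs, Term.size, Term.shift] at *
        omega
      · have h1 := Term.esCount_rename (· + (C.depth + 1)) w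
        have h2 := hw.esCount_eq_zero h
        have := ih3 h
        simp only [Redex.exprs, Term.esCount, Term.shift, dbCount, List.countP_cons,
          Redex.isDB, Bool.false_eq_true, if_false] at *
        omega

end LSC

theorem mainTheorem7 (k : ℕ) (t u : LSC.Term) (ρ : List LSC.Redex)
    (hρ : LSC.IsDerivation t ρ u) (hk : ρ.length = k) (hstd : LSC.IsStandard ρ) :
    (∀ (D : LSC.Ctx) (hD : D.Shallow) (C : LSC.Ctx) (hC : C.Shallow) (w : LSC.Term),
        LSC.Redex.ls D hD C hC w ∈ ρ → LSC.IsSubterm D.depth w t) ∧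
      u.size ≤ (k + 1) * t.size ∧
      (t.IsLambda → u.esCount = LSC.dbCount ρ) := by
  subst hk
  -- The empty context serves as the position preceding the first step: its path has no `appR`, so
  -- nothing is `Before` it.
  obtain ⟨h1, h2, h3⟩ := hρ.bounds (t₀ := t) (P := .hole) hstd rfl (LSC.IsSubterm.refl t).argsFrom
    (by rintro R θ -; cases R.position <;> simp [LSC.Ctx.Before, LSC.Ctx.path])
  exact ⟨h1, by rw [Nat.succ_mul]; omega, fun h => by rw [h3 h, h.esCount_eq_zero, zero_add]⟩
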